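/- Conventions: graphs are finite and simple; the order of a graph or path is its number of vertices. For a graph $G$, $\tau(G)$ (the detour order of $G$) is the order of a longest path in $G$; $\tau_G(v)$ is the order of a longest path with initial vertex $v$; $\tau_G(a,b)$ is the order of a longest path with endvertices $a,b$. A graph is traceable if it has a hamiltonian path. A CND graph is a connected, nontraceable graph in which all vertices $v$ have the same $\tau_G(v)$. A graph $G$ of order $k$ is an inflator graph with drop $m$, where $m$ is a positive integer with $m\le k-2$, and with distinguished vertices $a\neq b$, if: (1) $\tau_G(a,b)=k-m$; (2) each of $a,b$ is an initial vertex of a path containing all the vertices of $G$ except the other one; (3) each of $a,b$ is an initial vertex of a hamiltonian path of $G$; (4) for every vertex $v\notin\{a,b\}$ there are a path $P$ from $v$ to one of $a,b$ and a path $Q$ (possibly a single vertex) with initial vertex the other one such that $V(P)\cap V(Q)=\emptyset$ and $V(P)\cup V(Q)=V(G)$. A graph $M$ is an HCTV graph (homogeneously connected from two vertices) if it is $K_1$ (both anchors are then its only vertex), or if it has two distinct vertices $x,y$, called anchors, such that each vertex of $M$ is an initial vertex of a hamiltonian path of $M$ whose other endvertex is $x$ or $y$. Theorem. Let $n\ge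 2$, let $m,k_1,\dots,k_n$ be positive integers with $m+2\le\min\{k_1,\dots,k_n\}$, let $G_1,\dots,G_n$ be inflator graphs of orders $k_1,\dots,k_n$, all with the same drop $m$, and let $M_1,\dots,M_n$ be HCTV graphs, each of order at least $m$. Let $F=\mathcal F(G_1,\dots,G_n,M_1,\dots,M_n)$ be the graph obtained from the cycle $C_n$ (for $n=2$, two vertices joined by two parallel edges) by inflating each vertex $v_i$ with $G_i$ and inserting $M_i$ in each edge $e_i=v_iv_{i+1}$ (indices modulo $n$). That is, $F$ is the disjoint union of the $G_i$ and $M_i$ together with the edges $b_ix_i$ and $y_ia_{i+1}$ for $i=1,\dots,n$, where $a_i,b_i$ are the distinguished vertices of $G_i$ and $x_i,y_i$ the anchors of $M_i$, each pair in an arbitrary order. Then $F$ is a CND graph, and its detour order is $$\tau(F)=\sum_{i=1}^n k_i+\sum_{i=1}^n |V(M_i)|-(n-1)m .$$ -/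

import Mathlib

universe u v

namespace Detour

section Basic

variable {V : Type u} (G : SimpleGraph V)

/-- `τ_G(a, b)`: the order (number of vertices) of a longest path with endvertices `a` and `b`
(all graphs considered are finite; the value is `0` if there is no such path). -/
noncomputable def orderBetween (a b : V) : ℕ :=
  sSup {k | ∃ p : G.Walk a b, p.IsPath ∧ p.support.length = k}

/-- `τ_G(a)`: the order of a longest path with initial vertex `a`. -/
noncomputable def vertexOrder (a : V) : ℕ :=
  sSup {k | ∃ (b : V) (p : G.Walk a b), p.IsPath ∧ p.support.length = k}

/-- `τ(G)`: the order of a longest path in `G`. -/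
noncomputable def order : ℕ :=
  sSup {k | ∃ (a b : V) (p : G.Walk a b), p.IsPath ∧ p.support.length = k}

open Classical in
/-- `G` is traceable: it contains a hamiltonian path. -/
def IsTraceable : Prop :=
  ∃ (a b : V) (p : G.Walk a b), p.IsHamiltonian

/-- A connected, nontraceable, detour graph: the detour orders of all vertices coincide. -/
structure IsCND : Prop where
  connected : G.Connected
  nontraceable : ¬ IsTraceable G
  detour : ∀ a b : V, vertexOrder G a = vertexOrder G b

open Classical in
/-- `G` is homogeneously connected from two vertices, with anchors `x` and `y`: either `G` is `K₁`
(and then necessarily `x = y`), or `x ≠ y` and each vertex is the initial vertex of a hamiltonian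
path whose other endvertex is `x` or `y`. -/
def IsHCTV [Fintype V] (x y : V) : Prop :=
  Fintype.card V = 1 ∨
    (x ≠ y ∧ ∀ w : V, (∃ p : G.Walk w x, p.IsHamiltonian) ∨ (∃ p : G.Walk w y, p.IsHamiltonian))

open Classical in
/-- `G` is an inflator graph with drop `m` and distinguished vertices `a` and `b`. -/
structure IsInflator [Fintype V] (m : ℕ) (a b : V) : Prop where
  drop_pos : 0 < m
  drop_le : m + 2 ≤ Fintype.card V
  ne : a ≠ b
  /-- `τ_G(a, b) = k - m`, where `k` is the order of `G`. -/
  orderBetween_eq : orderBetween G a b = Fintype.card V - m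
  /-- From each distinguished vertex there is a path that contains all vertices except the
  other distinguished vertex. -/
  avoid_right : ∃ (w : V) (p : G.Walk a w), p.IsPath ∧ ∀ z, z ∈ p.support ↔ z ≠ b
  avoid_left : ∃ (w : V) (p : G.Walk b w), p.IsPath ∧ ∀ z, z ∈ p.support ↔ z ≠ a
  /-- `G` is traceable from each distinguished vertex. -/
  traceable_left : ∃ (w : V) (p : G.Walk a w), p.IsHamiltonian
  traceable_right : ∃ (w : V) (p : G.Walk b w), p.IsHamiltonian
  /-- For every other vertex `v` there are disjoint paths that together span `G`, one from `v` to
  a distinguished vertex `c` and one with initial vertex the other distinguished vertex `d`. -/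
  split : ∀ v : V, v ≠ a → v ≠ b →
    ∃ c d : V, ((c = a ∧ d = b) ∨ (c = b ∧ d = a)) ∧
      ∃ (w : V) (p : G.Walk v c) (q : G.Walk d w), p.IsPath ∧ q.IsPath ∧
        (∀ z, ¬ (z ∈ p.support ∧ z ∈ q.support)) ∧ (∀ z, z ∈ p.support ∨ z ∈ q.support)

end Basic

section Construction

variable {n : ℕ} [NeZero n] {V : Fin n → Type u} {W : Fin n → Type v}

/-- The edges of `𝓕(G₁, …, Gₙ, M₁, …, Mₙ)`. The cycle `Cₙ` has vertices `i : Fin n` and its `i`-th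
edge joins `i` to `i + 1` (cyclically). Vertex `i` is replaced with `G i`, whose distinguished
vertices are `a i` (towards the preceding edge) and `b i` (towards the following edge). The `i`-th
edge is replaced with `M i`, whose anchors `x i`, `y i` are joined to `b i` and `a (i + 1)`. -/
inductive InflateInsertRel (G : ∀ i, SimpleGraph (V i)) (a b : ∀ i, V i)
    (M : ∀ i, SimpleGraph (W i)) (x y : ∀ i, W i) :
    ((Σ i, V i) ⊕ (Σ i, W i)) → ((Σ i, V i) ⊕ (Σ i, W i)) → Prop
  | inflator (i : Fin n) (s t : V i) (h : (G i).Adj s t) :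
      InflateInsertRel G a b M x y (Sum.inl ⟨i, s⟩) (Sum.inl ⟨i, t⟩)
  | inserted (i : Fin n) (s t : W i) (h : (M i).Adj s t) :
      InflateInsertRel G a b M x y (Sum.inr ⟨i, s⟩) (Sum.inr ⟨i, t⟩)
  | enter (i : Fin n) :
      InflateInsertRel G a b M x y (Sum.inl ⟨i, b i⟩) (Sum.inr ⟨i, x i⟩)
  | leave (i : Fin n) :
      InflateInsertRel G a b M x y (Sum.inr ⟨i, y i⟩) (Sum.inl ⟨i + 1, a (i + 1)⟩)

/-- The graph `𝓕(G₁, …, Gₙ, M₁, …, Mₙ)` obtained by inflating the vertices of a cycle `Cₙ` with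
the `G i` and inserting the `M i` in its edges. -/
def inflateInsert (G : ∀ i, SimpleGraph (V i)) (a b : ∀ i, V i)
    (M : ∀ i, SimpleGraph (W i)) (x y : ∀ i, W i) :
    SimpleGraph ((Σ i, V i) ⊕ (Σ i, W i)) :=
  SimpleGraph.fromRel (InflateInsertRel G a b M x y)

end Construction

end Detour

/-! Put `κ i = k_i - m`. The claimed detour order is `∑ κ + ∑ |M_i| + m`: every inflator graph but
one loses `m` vertices. Lower bound, from every vertex. A vertex of `G_i` starts a path that takes
one half of a split of `G_i`, goes once around the cycle through all other pieces, and returns to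
take the other half (`exists_pathOn_from_inl`). A vertex of `M_i` starts a path that spans `M_i`,
leaves at one anchor, goes around, and ends with a hamiltonian path of the inflator graph at the
other anchor (`exists_pathOn_from_inr`). Upper bound (`length_support_le`). Only two edges leave
each piece. A path with no end in `G_i` therefore crosses it at most once, between `a_i` and `b_i`,
and misses at least `m` of its vertices (`exists_list_of_ends_notMem`). This suffices unless the
ends lie in two different inflator graphs. In that case a parity argument on the cuts shows that
some `M_k` is missed entirely (`exists_insertedSet_missed`), and `|M_k| ≥ m` compensates. The bounds
agree at all vertices, and the common value is below the order of the graph because `(n - 1) * m >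
0`. -/

namespace Detour

/-! ### Paths as vertex lists, and the detour orders as attained suprema. -/

section PathOn

variable {V : Type u} {V' : Type v} {G : SimpleGraph V} {H : SimpleGraph V'}

/-- There is a path of `G` from `u` to `w` whose list of vertices is `l`. -/
def PathOn (G : SimpleGraph V) (u w : V) (l : List V) : Prop :=
  ∃ p : G.Walk u w, p.IsPath ∧ p.support = l

theorem PathOn.nil (G : SimpleGraph V) (u : V) : PathOn G u u [u] :=
  ⟨SimpleGraph.Walk.nil, by simp, by simp⟩

theorem PathOn.nodup {u w : V} {l : List V} (h : PathOn G u w l) : l.Nodup := by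
  obtain ⟨p, hp, rfl⟩ := h
  exact hp.support_nodup

theorem PathOn.reverse {u w : V} {l : List V} (h : PathOn G u w l) : PathOn G w u l.reverse := by
  obtain ⟨p, hp, rfl⟩ := h
  exact ⟨p.reverse, hp.reverse, by simp⟩

theorem PathOn.join {u v v' w : V} {l l' : List V} (h : PathOn G u v l) (hv : G.Adj v v')
    (h' : PathOn G v' w l') (hd : ∀ z ∈ l, z ∉ l') : PathOn G u w (l ++ l') := by
  have hn := h.nodup
  have hn' := h'.nodup
  obtain ⟨p, hp, rfl⟩ := h
  obtain ⟨q, hq, rfl⟩ := h'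
  have hs : (p.append (q.cons hv)).support = p.support ++ q.support := by
    simp [SimpleGraph.Walk.support_append]
  refine ⟨p.append (q.cons hv), ?_, hs⟩
  rw [SimpleGraph.Walk.isPath_def, hs]
  exact List.nodup_append'.2 ⟨hn, hn', fun z hz hz' => hd z hz hz'⟩

theorem PathOn.map {u w : V} {l : List V} (h : PathOn G u w l) (f : G →g H)
    (hf : Function.Injective f) : PathOn H (f u) (f w) (l.map f) := by
  obtain ⟨p, hp, rfl⟩ := h
  exact ⟨p.map f, hp.map hf, by simp⟩

theorem PathOn.reachable {u w : V} {l : List V} (h : PathOn G u w l) : G.Reachable u w :=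
  h.elim fun p _ => p.reachable

theorem length_support_le_card [Fintype V] {u w : V} {p : G.Walk u w} (hp : p.IsPath) :
    p.support.length ≤ Fintype.card V :=
  hp.support_nodup.length_le_card

theorem PathOn.length_le_vertexOrder [Fintype V] {u w : V} {l : List V} (h : PathOn G u w l) :
    l.length ≤ vertexOrder G u := by
  obtain ⟨p, hp, rfl⟩ := h
  refine le_csSup ⟨Fintype.card V, ?_⟩ ⟨w, p, hp, rfl⟩
  rintro _ ⟨_, q, hq, rfl⟩
  exact length_support_le_card hq

theorem PathOn.length_le_order [Fintype V] {u w : V} {l : List V} (h : PathOn G u w l) :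
    l.length ≤ order G := by
  obtain ⟨p, hp, rfl⟩ := h
  refine le_csSup ⟨Fintype.card V, ?_⟩ ⟨u, w, p, hp, rfl⟩
  rintro _ ⟨_, _, q, hq, rfl⟩
  exact length_support_le_card hq

theorem PathOn.length_le_orderBetween [Fintype V] {u w : V} {l : List V} (h : PathOn G u w l) :
    l.length ≤ orderBetween G u w := by
  obtain ⟨p, hp, rfl⟩ := h
  refine le_csSup ⟨Fintype.card V, ?_⟩ ⟨p, hp, rfl⟩
  rintro _ ⟨q, hq, rfl⟩
  exact length_support_le_card hq

/-- Positivity rules out the default value `sSup ∅ = 0`; a nonempty bounded set of naturals attains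
its supremum. -/
theorem exists_pathOn_orderBetween [Fintype V] {u w : V} (h : 0 < orderBetween G u w) :
    ∃ l, PathOn G u w l ∧ l.length = orderBetween G u w := by
  have hne : {k | ∃ p : G.Walk u w, p.IsPath ∧ p.support.length = k}.Nonempty := by
    rw [Set.nonempty_iff_ne_empty]
    intro h0
    rw [orderBetween, h0, csSup_empty] at h
    exact lt_irrefl _ h
  obtain ⟨p, hp, hk⟩ := Nat.sSup_mem hne ⟨Fintype.card V, by
    rintro _ ⟨q, hq, rfl⟩
    exact length_support_le_card hq⟩
  exact ⟨_, ⟨p, hp, rfl⟩, hk⟩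

theorem vertexOrder_le {u : V} {N : ℕ}
    (h : ∀ (w : V) (p : G.Walk u w), p.IsPath → p.support.length ≤ N) : vertexOrder G u ≤ N := by
  refine csSup_le ⟨_, u, SimpleGraph.Walk.nil, by simp, rfl⟩ ?_
  rintro _ ⟨w, p, hp, rfl⟩
  exact h w p hp

theorem order_le [Nonempty V] {N : ℕ}
    (h : ∀ (u w : V) (p : G.Walk u w), p.IsPath → p.support.length ≤ N) : order G ≤ N := by
  obtain ⟨u⟩ := ‹Nonempty V›
  refine csSup_le ⟨_, u, u, SimpleGraph.Walk.nil, by simp, rfl⟩ ?_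
  rintro _ ⟨u, w, p, hp, rfl⟩
  exact h u w p hp

theorem pathOn_of_isHamiltonian [DecidableEq V] [Fintype V] {u w : V} {p : G.Walk u w}
    (hp : p.IsHamiltonian) : ∃ l, PathOn G u w l ∧ l.length = Fintype.card V :=
  ⟨_, ⟨p, hp.isPath, rfl⟩, hp.length_support⟩

theorem IsTraceable.exists_pathOn [Fintype V] (h : IsTraceable G) :
    ∃ u w l, PathOn G u w l ∧ l.length = Fintype.card V := by
  classical
  obtain ⟨u, w, p, hp⟩ := h
  exact ⟨u, w, pathOn_of_isHamiltonian hp⟩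

theorem length_eq_card_of_forall_mem [Fintype V] {l : List V} (hn : l.Nodup) (h : ∀ z, z ∈ l) :
    l.length = Fintype.card V := by
  classical
  rw [← List.toFinset_card_of_nodup hn, ← Finset.card_univ]
  congr 1
  ext z
  simp [h z]

end PathOn

/-! ### Paths supplied by the inflator and HCTV graphs. -/

section Pieces

variable {V : Type u} {G : SimpleGraph V} [Fintype V]

theorem IsHCTV.exists_pathOn {x y : V} (h : IsHCTV G x y) (w : V) :
    (∃ l, PathOn G w x l ∧ l.length = Fintype.card V) ∨
      (∃ l, PathOn G w y l ∧ l.length = Fintype.card V) := by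
  classical
  rcases h with h | ⟨-, h⟩
  · obtain rfl : w = x := (Fintype.card_le_one_iff.1 h.le) w x
    exact Or.inl ⟨_, PathOn.nil G w, by simp [h]⟩
  · rcases h w with ⟨p, hp⟩ | ⟨p, hp⟩
    · exact Or.inl (pathOn_of_isHamiltonian hp)
    · exact Or.inr (pathOn_of_isHamiltonian hp)

/-- Apply the definition to the vertex `x`. If the hamiltonian path ends in `x` again, it is a
single vertex, so the graph is `K₁` and the anchors coincide. -/
theorem IsHCTV.exists_pathOn_anchors {x y : V} (h : IsHCTV G x y) :
    ∃ l, PathOn G x y l ∧ l.length = Fintype.card V := by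
  rcases h.exists_pathOn x with ⟨l, ⟨p, hp, rfl⟩, hl⟩ | h'
  · have h1 : Fintype.card V = 1 := by
      rw [← hl, SimpleGraph.Walk.nil_iff_support_eq.1 (SimpleGraph.Walk.isPath_iff_nil.1 hp)]
      rfl
    obtain rfl : x = y := (Fintype.card_le_one_iff.1 h1.le) x y
    exact ⟨_, PathOn.nil G x, by simp [h1]⟩
  · exact h'

theorem IsInflator.exists_pathOn_between {m : ℕ} {a b : V} (h : IsInflator G m a b) :
    ∃ l, PathOn G a b l ∧ l.length + m = Fintype.card V := by
  have h1 := h.orderBetween_eq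
  have h2 := h.drop_le
  obtain ⟨l, hl, hk⟩ := exists_pathOn_orderBetween (G := G) (u := a) (w := b) (by omega)
  exact ⟨l, hl, by omega⟩

theorem IsInflator.length_add_le {m : ℕ} {a b : V} (h : IsInflator G m a b) {l : List V}
    (hl : PathOn G a b l ∨ PathOn G b a l) : l.length + m ≤ Fintype.card V := by
  have h1 := h.orderBetween_eq
  have h2 := h.drop_le
  rcases hl with hl | hl
  · have := hl.length_le_orderBetween
    omega
  · have := hl.reverse.length_le_orderBetween
    rw [List.length_reverse] at this
    omega

theorem IsInflator.exists_pathOn_left {m : ℕ} {a b : V} (h : IsInflator G m a b) :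
    ∃ w l, PathOn G a w l ∧ l.length = Fintype.card V := by
  classical
  obtain ⟨w, p, hp⟩ := h.traceable_left
  exact ⟨w, pathOn_of_isHamiltonian hp⟩

theorem IsInflator.exists_pathOn_right {m : ℕ} {a b : V} (h : IsInflator G m a b) :
    ∃ w l, PathOn G b w l ∧ l.length = Fintype.card V := by
  classical
  obtain ⟨w, p, hp⟩ := h.traceable_right
  exact ⟨w, pathOn_of_isHamiltonian hp⟩

/-- The splitting condition extends to `a` and `b` themselves: the first path is the single vertex,
and the second is the path from the other distinguished vertex that avoids it. -/
theorem IsInflator.exists_split {m : ℕ} {a b : V} (h : IsInflator G m a b) (s : V) :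
    ∃ c d : V, ((c = a ∧ d = b) ∨ (c = b ∧ d = a)) ∧
      ∃ w l l', PathOn G s c l ∧ PathOn G d w l' ∧ (∀ z ∈ l, z ∉ l') ∧
        l.length + l'.length = Fintype.card V := by
  suffices hs : ∃ c d : V, ((c = a ∧ d = b) ∨ (c = b ∧ d = a)) ∧
      ∃ w l l', PathOn G s c l ∧ PathOn G d w l' ∧ (∀ z ∈ l, z ∉ l') ∧ (∀ z, z ∈ l ∨ z ∈ l') by
    obtain ⟨c, d, hcd, w, l, l', hl, hl', hd, hc⟩ := hs
    refine ⟨c, d, hcd, w, l, l', hl, hl', hd, ?_⟩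
    rw [← List.length_append]
    exact length_eq_card_of_forall_mem
      (List.nodup_append'.2 ⟨hl.nodup, hl'.nodup, fun z hz hz' => hd z hz hz'⟩)
      (fun z => List.mem_append.2 (hc z))
  by_cases hsa : s = a
  · subst hsa
    obtain ⟨w, p, hp, hz⟩ := h.avoid_left
    exact ⟨s, b, Or.inl ⟨rfl, rfl⟩, w, [s], _, PathOn.nil G s, ⟨p, hp, rfl⟩,
      by simp [hz], fun z => by rw [hz]; simp [em]⟩
  by_cases hsb : s = b
  · subst hsb
    obtain ⟨w, p, hp, hz⟩ := h.avoid_right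
    exact ⟨s, a, Or.inr ⟨rfl, rfl⟩, w, [s], _, PathOn.nil G s, ⟨p, hp, rfl⟩,
      by simp [hz], fun z => by rw [hz]; simp [em]⟩
  obtain ⟨c, d, hcd, w, p, q, hp, hq, h1, h2⟩ := h.split s hsa hsb
  exact ⟨c, d, hcd, w, _, _, ⟨p, hp, rfl⟩, ⟨q, hq, rfl⟩, fun z hz hz' => h1 z ⟨hz, hz'⟩, h2⟩

end Pieces

/-! ### Paths across a cut of at most two edges. -/

section Cut

open SimpleGraph

variable {V : Type u} {V' : Type v} {G : SimpleGraph V} {H : SimpleGraph V'}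

/-- Every edge of `G` that leaves `S` is `e` or `f`. -/
def CutBy (G : SimpleGraph V) (S : Set V) (e f : Sym2 V) : Prop :=
  ∀ s t, s ∈ S → t ∉ S → G.Adj s t → s(s, t) = e ∨ s(s, t) = f

theorem CutBy.compl {S : Set V} {e f : Sym2 V} (h : CutBy G S e f) : CutBy G Sᶜ e f := by
  intro s t hs ht hst
  rw [Sym2.eq_swap]
  exact h t s (not_not.1 ht) hs hst.symm

theorem CutBy.mem_iff_of_notMem_edges {S : Set V} {e f : Sym2 V} (h : CutBy G S e f) {u w : V}
    (p : G.Walk u w) (he : e ∉ p.edges) (hf : f ∉ p.edges) :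
    ∀ z ∈ p.support, (z ∈ S ↔ u ∈ S) := by
  induction p with
  | nil => simp
  | @cons u v w huv p ih =>
    simp only [Walk.edges_cons, List.mem_cons, not_or] at he hf
    have hv : v ∈ S ↔ u ∈ S := by
      by_contra hc
      by_cases hu : u ∈ S
      · have hv : v ∉ S := by tauto
        rcases h u v hu hv huv with h | h
        · exact he.1 h.symm
        · exact hf.1 h.symm
      · have hv : v ∈ S := by tauto
        rcases h v u hv hu huv.symm with h | h
        · exact he.1 (h.symm.trans Sym2.eq_swap)
        · exact hf.1 (h.symm.trans Sym2.eq_swap)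
    intro z hz
    rw [Walk.support_cons, List.mem_cons] at hz
    rcases hz with rfl | hz
    · rfl
    · exact (ih he.2 hf.2 z hz).trans hv

/-- Parity: a walk changes sides exactly when it traverses `e` or `f`, and a trail traverses each at
most once. Its ends are on the same side iff it uses both edges or neither. -/
theorem CutBy.mem_edges_iff {S : Set V} {e f : Sym2 V} (h : CutBy G S e f) (hef : e ≠ f)
    (he : ∀ s t, s(s, t) = e → (s ∈ S ↔ t ∉ S)) (hf : ∀ s t, s(s, t) = f → (s ∈ S ↔ t ∉ S))
    {u w : V} (p : G.Walk u w) (hp : p.IsTrail) :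
    (u ∈ S ↔ w ∈ S) ↔ (e ∈ p.edges ↔ f ∈ p.edges) := by
  induction p with
  | nil => simp
  | @cons u v w huv p ih =>
    rw [Walk.isTrail_cons] at hp
    have ih := ih hp.1
    have hn := hp.2
    simp only [Walk.edges_cons, List.mem_cons]
    have he' := he u v
    have hf' := hf u v
    have h1 : (u ∈ S ↔ v ∉ S) → s(u, v) = e ∨ s(u, v) = f := by
      intro hc
      by_cases hu : u ∈ S
      · exact h u v hu (by tauto) huv
      · exact h.compl u v hu (by simp only [Set.mem_compl_iff]; tauto) huv
    by_cases hc : u ∈ S ↔ v ∉ S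
    · rcases h1 hc with rfl | rfl
      · simp only [hef.symm, hn, true_or, false_or, true_iff, false_iff] at ih ⊢
        clear he hf he' hf' h1
        by_cases hu : u ∈ S <;> by_cases hv : v ∈ S <;> by_cases hw : w ∈ S <;> simp_all
      · simp only [hef, hn, true_or, false_or, iff_true, iff_false] at ih ⊢
        clear he hf he' hf' h1
        by_cases hu : u ∈ S <;> by_cases hv : v ∈ S <;> by_cases hw : w ∈ S <;> simp_all
    · have h2 : e ≠ s(u, v) := fun h => hc (he' h.symm)
      have h3 : f ≠ s(u, v) := fun h => hc (hf' h.symm)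
      have h4 : u ∈ S ↔ v ∈ S := by
        clear he hf he' hf' h1 ih
        by_cases hu : u ∈ S <;> by_cases hv : v ∈ S <;> simp_all
      simp only [h2, h3, false_or, h4, ih]

theorem exists_append_of_mem_of_notMem {S : Set V} {u w : V} (p : G.Walk u w) (hu : u ∈ S)
    (hw : w ∉ S) : ∃ (s t : V) (q : G.Walk u s) (h : G.Adj s t) (r : G.Walk t w),
      p = q.append (r.cons h) ∧ (∀ z ∈ q.support, z ∈ S) ∧ t ∉ S := by
  induction p with
  | nil => exact absurd hu hw
  | @cons u v w huv p ih =>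
    by_cases hv : v ∈ S
    · obtain ⟨s, t, q, h, r, rfl, hq, ht⟩ := ih hv hw
      refine ⟨s, t, q.cons huv, h, r, by simp, ?_, ht⟩
      intro z hz
      rw [Walk.support_cons, List.mem_cons] at hz
      rcases hz with rfl | hz
      · exact hu
      · exact hq z hz
    · exact ⟨u, v, Walk.nil, huv, p, by simp, by simpa using hu, hv⟩

/-- A path with both ends outside `S` that visits `S` does so in one subpath between the two edges
that leave `S`. -/
theorem CutBy.exists_subpath {S : Set V} {e f : Sym2 V} (h : CutBy G S e f) {u w : V}
    (p : G.Walk u w) (hp : p.IsPath) (hu : u ∉ S) (hw : w ∉ S) {z : V} (hz : z ∈ p.support)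
    (hzS : z ∈ S) : ∃ (s t s' t' : V) (q : G.Walk s s'), q.IsPath ∧ (∀ z ∈ q.support, z ∈ S) ∧
      t ∉ S ∧ t' ∉ S ∧ s(s, t) ≠ s(s', t') ∧ G.Adj s t ∧ G.Adj s' t' ∧
      ∀ z ∈ p.support, z ∈ S → z ∈ q.support := by
  classical
  obtain ⟨p₁, p₂, rfl⟩ := Walk.mem_support_iff_exists_append.1 hz
  obtain ⟨t, s, q₁, hts, r₁, rfl, hq₁, hs⟩ :=
    exists_append_of_mem_of_notMem (S := Sᶜ) p₁ hu (by simpa using hzS)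
  replace hs : s ∈ S := by simpa using hs
  obtain ⟨s', t', q, hst', r, hr, hq, ht'⟩ :=
    exists_append_of_mem_of_notMem (r₁.append p₂) hs hw
  have hp' : (q₁.append (r₁.cons hts)).append p₂ =
      q₁.append ((q.append (r.cons hst')).cons hts) := by
    rw [← hr, ← Walk.append_assoc, Walk.cons_append]
  rw [hp'] at hp ⊢
  have hqs' : s' ∈ S := hq s' (by simp)
  have htr := hp.isTrail
  have ht : t ∉ S := hq₁ t (by simp)
  have hnd := htr.edges_nodup
  simp only [Walk.edges_append, Walk.edges_cons, List.nodup_append', List.nodup_cons,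
    List.mem_append, List.mem_cons, not_or, List.disjoint_cons_right] at hnd
  have hne : s(s, t) ≠ s(s', t') := by
    rw [Sym2.eq_swap]
    exact hnd.2.1.1.2.1
  have hr1 : s(s', t') ∉ r.edges := hnd.2.1.2.2.1.1
  have hr2 : s(s, t) ∉ r.edges := by
    rw [Sym2.eq_swap]
    exact hnd.2.1.1.2.2
  -- Entering and leaving `S` has used up both edges of the cut, so the remainder `r` can never
  -- return to `S`.
  have hr0 : e ∉ r.edges ∧ f ∉ r.edges := by
    rcases h s t hs ht hts.symm with h1 | h1 <;> rcases h s' t' hqs' ht' hst' with h2 | h2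
    · exact absurd (h1.trans h2.symm) hne
    · exact ⟨h1 ▸ hr2, h2 ▸ hr1⟩
    · exact ⟨h2 ▸ hr1, h1 ▸ hr2⟩
    · exact absurd (h1.trans h2.symm) hne
  have hrS := h.mem_iff_of_notMem_edges r hr0.1 hr0.2
  refine ⟨s, t, s', t', q, ?_, hq, ht, ht', hne, hts.symm, hst', ?_⟩
  · exact hp.of_append_right.of_cons.of_append_left
  · intro z hz hzS
    simp only [Walk.mem_support_append_iff, Walk.support_cons, List.mem_cons] at hz
    rcases hz with hz | rfl | hz | rfl | hz
    · exact absurd hzS (hq₁ z hz)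
    · exact absurd hzS ht
    · exact hz
    · simp
    · exact absurd ((hrS z hz).1 hzS) ht'

theorem exists_walk_of_support_subset_range {f : V → V'}
    (hf : Function.Injective f) (hadj : ∀ s t, H.Adj (f s) (f t) → G.Adj s t) {u w : V'}
    (p : H.Walk u w) (hp : ∀ z ∈ p.support, z ∈ Set.range f) :
    ∀ s t, u = f s → w = f t → ∃ q : G.Walk s t, q.support.map f = p.support := by
  induction p with
  | nil =>
    rintro s t rfl h
    obtain rfl := hf h
    exact ⟨Walk.nil, by simp⟩
  | @cons u v w huv p ih =>
    rintro s t rfl rfl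
    obtain ⟨r, rfl⟩ := hp v (by simp)
    obtain ⟨q, hq⟩ := ih (fun z hz => hp z (by simp [hz])) r t rfl rfl
    exact ⟨q.cons (hadj _ _ huv), by simp [hq]⟩

end Cut

/-! ### Iterating the successor on the cyclic index set. -/

section Rotation

variable {n : ℕ} [NeZero n]

theorem val_iterate_add_one (i : Fin n) (k : ℕ) : ((· + 1)^[k] i : Fin n).val = (i.val + k) % n := by
  induction k with
  | zero => simp [Nat.mod_eq_of_lt i.isLt]
  | succ k ih =>
    rw [Function.iterate_succ_apply', Fin.val_add, ih, Fin.val_one', ← Nat.add_mod, add_assoc]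

theorem iterate_add_one_self (i : Fin n) : ((· + 1)^[n] i : Fin n) = i := by
  apply Fin.ext
  rw [val_iterate_add_one, Nat.add_mod_right, Nat.mod_eq_of_lt i.isLt]

theorem iterate_add_one_injOn (i : Fin n) {k l : ℕ} (hk : k < n) (hl : l < n)
    (h : ((· + 1)^[k] i : Fin n) = (· + 1)^[l] i) : k = l := by
  have h' := congrArg Fin.val h
  rw [val_iterate_add_one, val_iterate_add_one] at h'
  exact Nat.ModEq.eq_of_lt_of_lt (Nat.ModEq.add_left_cancel' i.val h') hk hl

theorem iterate_add_one_ne (i : Fin n) {k : ℕ} (hk : k < n) (h0 : k ≠ 0) :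
    ((· + 1)^[k] i : Fin n) ≠ i :=
  fun h => h0 (iterate_add_one_injOn i hk (NeZero.pos n) h)

theorem add_one_ne_self (hn : 2 ≤ n) (i : Fin n) : i + 1 ≠ i :=
  iterate_add_one_ne i (k := 1) (by omega) one_ne_zero

theorem sum_iterate_add_one (i : Fin n) (f : Fin n → ℕ) :
    ∑ k ∈ Finset.range n, f ((· + 1)^[k] i) = ∑ j, f j := by
  rw [Finset.sum_range]
  have hinj : Function.Injective (fun k : Fin n => ((· + 1)^[k.val] i : Fin n)) :=
    fun k l h => Fin.ext (iterate_add_one_injOn i k.isLt l.isLt h)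
  exact (Finite.injective_iff_bijective.1 hinj).sum_comp f

end Rotation

/-! ### Adjacency in the construction and embedding of paths of the pieces. -/

section Inflate

variable {n : ℕ} [NeZero n] {V : Fin n → Type u} {W : Fin n → Type v}
  {G : ∀ i, SimpleGraph (V i)} {a b : ∀ i, V i} {M : ∀ i, SimpleGraph (W i)} {x y : ∀ i, W i}

local notation "𝓕" => inflateInsert G a b M x y

theorem inflateInsert_adj_inl {i : Fin n} {s t : V i} :
    (𝓕).Adj (Sum.inl ⟨i, s⟩) (Sum.inl ⟨i, t⟩) ↔ (G i).Adj s t := by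
  constructor
  · rintro ⟨-, h | h⟩
    · cases h with
      | inflator _ _ _ h => exact h
    · cases h with
      | inflator _ _ _ h => exact h.symm
  · intro h
    exact ⟨by simpa using h.ne, Or.inl (.inflator i s t h)⟩

theorem inflateInsert_adj_inr {i : Fin n} {s t : W i} (h : (M i).Adj s t) :
    (𝓕).Adj (Sum.inr ⟨i, s⟩) (Sum.inr ⟨i, t⟩) :=
  ⟨by simpa using h.ne, Or.inl (.inserted i s t h)⟩

theorem inflateInsert_adj_enter (i : Fin n) : (𝓕).Adj (Sum.inl ⟨i, b i⟩) (Sum.inr ⟨i, x i⟩) :=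
  ⟨by simp, Or.inl (.enter i)⟩

theorem inflateInsert_adj_leave {i j : Fin n} (h : j + 1 = i) :
    (𝓕).Adj (Sum.inr ⟨j, y j⟩) (Sum.inl ⟨i, a i⟩) := by
  subst h
  exact ⟨by simp, Or.inl (.leave j)⟩

omit [NeZero n] in
theorem inl_injective (i : Fin n) :
    Function.Injective (fun s : V i => (Sum.inl ⟨i, s⟩ : (Σ i, V i) ⊕ (Σ i, W i))) := by
  intro s t h
  simpa using h

omit [NeZero n] in
theorem inr_injective (i : Fin n) :
    Function.Injective (fun s : W i => (Sum.inr ⟨i, s⟩ : (Σ i, V i) ⊕ (Σ i, W i))) := by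
  intro s t h
  simpa using h

theorem PathOn.inl {i : Fin n} {s t : V i} {l : List (V i)} (h : PathOn (G i) s t l) :
    PathOn 𝓕 (Sum.inl ⟨i, s⟩) (Sum.inl ⟨i, t⟩) (l.map fun s => Sum.inl ⟨i, s⟩) :=
  h.map (⟨fun s => Sum.inl ⟨i, s⟩, fun h => inflateInsert_adj_inl.2 h⟩ : G i →g 𝓕)
    (inl_injective i)

theorem PathOn.inr {i : Fin n} {s t : W i} {l : List (W i)} (h : PathOn (M i) s t l) :
    PathOn 𝓕 (Sum.inr ⟨i, s⟩) (Sum.inr ⟨i, t⟩) (l.map fun s => Sum.inr ⟨i, s⟩) :=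
  h.map (⟨fun s => Sum.inr ⟨i, s⟩, fun h => inflateInsert_adj_inr h⟩ : M i →g 𝓕)
    (inr_injective i)

/-- The vertex or edge of the cycle from which a vertex of `𝓕` arises. -/
def position : (Σ i, V i) ⊕ (Σ i, W i) → Fin n := Sum.elim Sigma.fst Sigma.fst

/-! ### Lower bound: long paths from every vertex, and connectedness. -/

section Lower

variable [∀ i, Fintype (V i)] [∀ i, Fintype (W i)] {m : ℕ} {κ : Fin n → ℕ}

theorem exists_pathOn_segment (hG : ∀ i, IsInflator (G i) m (a i) (b i))
    (hM : ∀ i, IsHCTV (M i) (x i) (y i)) (hκ : ∀ i, κ i + m = Fintype.card (V i)) (i : Fin n) :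
    ∃ l, PathOn 𝓕 (Sum.inl ⟨i, a i⟩) (Sum.inr ⟨i, y i⟩) l ∧
      l.length = κ i + Fintype.card (W i) ∧ ∀ z ∈ l, position z = i := by
  obtain ⟨l, hl, hlc⟩ := (hG i).exists_pathOn_between
  obtain ⟨l', hl', hlc'⟩ := (hM i).exists_pathOn_anchors
  refine ⟨_, hl.inl.join (inflateInsert_adj_enter i) hl'.inr ?_, ?_, ?_⟩
  · simp
  · have := hκ i
    simp only [List.length_append, List.length_map]
    omega
  · intro z hz
    simp only [List.mem_append, List.mem_map] at hz
    rcases hz with ⟨s, -, rfl⟩ | ⟨s, -, rfl⟩ <;> rfl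

/-- The path through `M i, G (i + 1), M (i + 1), …, G (i + k), M (i + k)`. -/
theorem exists_pathOn_chain (hG : ∀ i, IsInflator (G i) m (a i) (b i))
    (hM : ∀ i, IsHCTV (M i) (x i) (y i)) (hκ : ∀ i, κ i + m = Fintype.card (V i)) (i : Fin n)
    (k : ℕ) (hk : k < n) :
    ∃ l, PathOn 𝓕 (Sum.inr ⟨i, x i⟩) (Sum.inr ⟨(· + 1)^[k] i, y ((· + 1)^[k] i)⟩) l ∧
      l.length = ∑ j ∈ Finset.range (k + 1), Fintype.card (W ((· + 1)^[j] i)) +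
        ∑ j ∈ Finset.range k, κ ((· + 1)^[j + 1] i) ∧
      (∀ z ∈ l, ∃ j ≤ k, position z = (· + 1)^[j] i) ∧ ∀ s : V i, Sum.inl ⟨i, s⟩ ∉ l := by
  induction k with
  | zero =>
    obtain ⟨l, hl, hlc⟩ := (hM i).exists_pathOn_anchors
    refine ⟨_, hl.inr, by simp [hlc], ?_, by simp⟩
    intro z hz
    obtain ⟨s, -, rfl⟩ := List.mem_map.1 hz
    exact ⟨0, le_rfl, rfl⟩
  | succ k ih =>
    obtain ⟨l, hl, hlc, hpos, havoid⟩ := ih (by omega)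
    obtain ⟨l', hl', hlc', hpos'⟩ := exists_pathOn_segment hG hM hκ ((· + 1)^[k + 1] i)
    refine ⟨_, hl.join (inflateInsert_adj_leave ?_) hl' ?_, ?_, ?_, ?_⟩
    · rw [Function.iterate_succ_apply']
    · intro z hz hz'
      obtain ⟨j, hj, h⟩ := hpos z hz
      have := iterate_add_one_injOn i hk (by omega) ((hpos' z hz').symm.trans h)
      omega
    · rw [List.length_append, hlc, hlc', Finset.sum_range_succ _ (k + 1),
        Finset.sum_range_succ (fun j => κ ((· + 1)^[j + 1] i)) k]
      omega
    · intro z hz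
      rcases List.mem_append.1 hz with hz | hz
      · obtain ⟨j, hj, h⟩ := hpos z hz
        exact ⟨j, by omega, h⟩
      · exact ⟨k + 1, le_rfl, hpos' z hz⟩
    · intro s hs
      rcases List.mem_append.1 hs with hs | hs
      · exact havoid s hs
      · exact iterate_add_one_ne i hk (by omega) (hpos' _ hs).symm

/-- The chain with `k = n - 1` contains every `M j` and crosses every inflator graph except `G i`.
It is inserted between the two halves of a split of `G i`, and is reversed if the first half ends in
`a i`. As `G i` is covered completely, one `m` is regained. -/
theorem exists_pathOn_from_inl (hG : ∀ i, IsInflator (G i) m (a i) (b i))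
    (hM : ∀ i, IsHCTV (M i) (x i) (y i)) (hκ : ∀ i, κ i + m = Fintype.card (V i)) (i : Fin n)
    (s : V i) : ∃ w l, PathOn 𝓕 (Sum.inl ⟨i, s⟩) w l ∧
      l.length = ∑ j, κ j + ∑ j, Fintype.card (W j) + m := by
  obtain ⟨k, hk⟩ : ∃ k, n = k + 1 := Nat.exists_eq_succ_of_ne_zero (NeZero.ne n)
  obtain ⟨l, hl, hlc, -, havoid⟩ := exists_pathOn_chain hG hM hκ i k (by omega)
  have hW := sum_iterate_add_one i fun j => Fintype.card (W j)
  have hκs := sum_iterate_add_one i κ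
  have hrange : Finset.range n = Finset.range (k + 1) := by rw [hk]
  rw [hrange, Finset.sum_range_succ', Function.iterate_zero, id] at hκs
  rw [← hrange, hW] at hlc
  have hi := hκ i
  have hlast : ((· + 1)^[k] i : Fin n) + 1 = i := by
    have h1 := iterate_add_one_self i
    have h2 : ((· + 1)^[n] i : Fin n) = (· + 1)^[k + 1] i := by rw [← hk]
    rwa [h2, Function.iterate_succ_apply'] at h1
  obtain ⟨c, d, hcd, w, l₁, l₂, hl₁, hl₂, hd, hc⟩ := (hG i).exists_split s
  rcases hcd with ⟨rfl, rfl⟩ | ⟨rfl, rfl⟩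
  · refine ⟨_, _, (hl₁.inl.join (inflateInsert_adj_leave hlast).symm hl.reverse ?_).join
      (inflateInsert_adj_enter i).symm hl₂.inl ?_, ?_⟩
    · intro z hz hz'
      obtain ⟨t, -, rfl⟩ := List.mem_map.1 hz
      exact havoid t (List.mem_reverse.1 hz')
    · intro z hz hz'
      obtain ⟨t, ht, rfl⟩ := List.mem_map.1 hz'
      rcases List.mem_append.1 hz with hz | hz
      · exact hd t ((List.mem_map_of_injective (inl_injective i)).1 hz) ht
      · exact havoid t (List.mem_reverse.1 hz)
    · simp only [List.length_append, List.length_map, List.length_reverse]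
      omega
  · refine ⟨_, _, (hl₁.inl.join (inflateInsert_adj_enter i) hl ?_).join
      (inflateInsert_adj_leave hlast) hl₂.inl ?_, ?_⟩
    · intro z hz hz'
      obtain ⟨t, -, rfl⟩ := List.mem_map.1 hz
      exact havoid t hz'
    · intro z hz hz'
      obtain ⟨t, ht, rfl⟩ := List.mem_map.1 hz'
      rcases List.mem_append.1 hz with hz | hz
      · exact hd t ((List.mem_map_of_injective (inl_injective i)).1 hz) ht
      · exact havoid t hz
    · simp only [List.length_append, List.length_map]
      omega

theorem exists_pathOn_from_inr (hn : 2 ≤ n) (hG : ∀ i, IsInflator (G i) m (a i) (b i))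
    (hM : ∀ i, IsHCTV (M i) (x i) (y i)) (hκ : ∀ i, κ i + m = Fintype.card (V i)) (i : Fin n)
    (s : W i) : ∃ w l, PathOn 𝓕 (Sum.inr ⟨i, s⟩) w l ∧
      l.length = ∑ j, κ j + ∑ j, Fintype.card (W j) + m := by
  -- The chain starts at `M (i + 1)` and ends at `M (i - 1)`, so it omits exactly `M i`, `G i` and
  -- `G (i + 1)`. One of these inflator graphs is crossed on the way out, the other is spanned at
  -- the end.
  obtain ⟨k, hk⟩ : ∃ k, n = k + 1 + 1 := ⟨n - 2, by omega⟩
  obtain ⟨l, hl, hlc, hpos, havoid⟩ := exists_pathOn_chain hG hM hκ (i + 1) k (by omega)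
  have hW := sum_iterate_add_one i fun j => Fintype.card (W j)
  have hκs := sum_iterate_add_one i κ
  have hrange : Finset.range n = Finset.range (k + 1 + 1) := by rw [hk]
  rw [hrange, Finset.sum_range_succ', Finset.sum_range_succ'] at hκs
  rw [hrange, Finset.sum_range_succ'] at hW
  -- The iterate of order `j + 1` at `i` is by definition the iterate of order `j` at `i + 1`.
  replace hW : ∑ j ∈ Finset.range (k + 1), Fintype.card (W ((· + 1)^[j] (i + 1))) +
    Fintype.card (W i) = ∑ j, Fintype.card (W j) := hW
  replace hκs : ∑ j ∈ Finset.range k, κ ((· + 1)^[j + 1] (i + 1)) + κ (i + 1) + κ i = ∑ j, κ j :=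
    hκs
  have hi := hκ i
  have hi' := hκ (i + 1)
  have hlast : ((· + 1)^[k] (i + 1) : Fin n) + 1 = i := by
    have h1 := iterate_add_one_self i
    have h2 : ((· + 1)^[n] i : Fin n) = (· + 1)^[k + 1 + 1] i := by rw [← hk]
    rwa [h2, Function.iterate_succ_apply', Function.iterate_succ_apply] at h1
  have hne : i + 1 ≠ i := add_one_ne_self hn i
  have hposi : ∀ z ∈ l, position z ≠ i := by
    intro z hz hzi
    obtain ⟨j, hj, h⟩ := hpos z hz
    exact iterate_add_one_ne i (k := j + 1) (by omega) (by omega)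
      (by rw [Function.iterate_succ_apply, ← h, hzi])
  rcases (hM i).exists_pathOn s with ⟨l₁, hl₁, hc₁⟩ | ⟨l₁, hl₁, hc₁⟩
  · obtain ⟨l₂, hl₂, hc₂⟩ := (hG i).exists_pathOn_between
    obtain ⟨w, l₃, hl₃, hc₃⟩ := (hG (i + 1)).exists_pathOn_right
    refine ⟨_, _, ((hl₁.inr.join (inflateInsert_adj_enter i).symm hl₂.reverse.inl ?_).join
      (inflateInsert_adj_leave hlast).symm hl.reverse ?_).join
      (inflateInsert_adj_enter (i + 1)).symm hl₃.inl ?_, ?_⟩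
    · simp
    · intro z hz hz'
      refine hposi z (List.mem_reverse.1 hz') ?_
      simp only [List.mem_append, List.mem_map] at hz
      rcases hz with ⟨t, -, rfl⟩ | ⟨t, -, rfl⟩ <;> rfl
    · intro z hz hz'
      obtain ⟨t, -, rfl⟩ := List.mem_map.1 hz'
      rcases List.mem_append.1 hz with hz | hz
      · have : position (V := V) (W := W) (Sum.inl ⟨i + 1, t⟩) = i := by
          simp only [List.mem_append, List.mem_map] at hz
          rcases hz with ⟨t', -, h⟩ | ⟨t', -, h⟩ <;> rw [← h] <;> rfl
        exact hne this
      · exact havoid t (List.mem_reverse.1 hz)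
    · simp only [List.length_append, List.length_map, List.length_reverse]
      omega
  · obtain ⟨l₂, hl₂, hc₂⟩ := (hG (i + 1)).exists_pathOn_between
    obtain ⟨w, l₃, hl₃, hc₃⟩ := (hG i).exists_pathOn_left
    refine ⟨_, _, ((hl₁.inr.join (inflateInsert_adj_leave rfl) hl₂.inl ?_).join
      (inflateInsert_adj_enter (i + 1)) hl ?_).join
      (inflateInsert_adj_leave hlast) hl₃.inl ?_, ?_⟩
    · simp
    · intro z hz hz'
      rcases List.mem_append.1 hz with hz | hz
      · obtain ⟨t, -, rfl⟩ := List.mem_map.1 hz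
        exact hposi _ hz' rfl
      · obtain ⟨t, -, rfl⟩ := List.mem_map.1 hz
        exact havoid t hz'
    · intro z hz hz'
      obtain ⟨t, -, rfl⟩ := List.mem_map.1 hz'
      rcases List.mem_append.1 hz with hz | hz
      · simp only [List.mem_append, List.mem_map] at hz
        rcases hz with ⟨t', -, h⟩ | ⟨t', -, h⟩
        · cases h
        · exact hne (congrArg position h)
      · exact hposi _ hz rfl
    · simp only [List.length_append, List.length_map]
      omega

theorem inflateInsert_connected (hG : ∀ i, IsInflator (G i) m (a i) (b i))
    (hM : ∀ i, IsHCTV (M i) (x i) (y i)) : (𝓕).Connected := by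
  have hb : ∀ i (s : V i), (𝓕).Reachable (Sum.inl ⟨i, s⟩) (Sum.inl ⟨i, a i⟩) := by
    intro i s
    obtain ⟨w, l, ⟨p, hp, rfl⟩, hl⟩ := (hG i).exists_pathOn_left
    classical
    have hs : s ∈ p.support := by
      have h1 : p.support.toFinset = Finset.univ := by
        rw [← Finset.card_eq_iff_eq_univ, List.toFinset_card_of_nodup hp.support_nodup, hl]
      rw [← List.mem_toFinset, h1]
      exact Finset.mem_univ s
    have h2 : PathOn (G i) (a i) s _ := ⟨_, hp.takeUntil hs, rfl⟩
    exact (h2.inl (a := a) (b := b) (M := M) (x := x) (y := y)).reachable.symm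
  have hx : ∀ i (s : W i), (𝓕).Reachable (Sum.inr ⟨i, s⟩) (Sum.inl ⟨i, a i⟩) := by
    intro i s
    have h1 : (𝓕).Reachable (Sum.inr ⟨i, s⟩) (Sum.inr ⟨i, x i⟩) := by
      rcases (hM i).exists_pathOn s with ⟨l, hl, -⟩ | ⟨l, hl, -⟩
      · exact hl.inr.reachable
      · obtain ⟨l', hl', -⟩ := (hM i).exists_pathOn_anchors
        exact hl.inr.reachable.trans hl'.inr.reachable.symm
    exact (h1.trans (inflateInsert_adj_enter i).reachable.symm).trans (hb i (b i))
  have hstep : ∀ i, (𝓕).Reachable (Sum.inl ⟨i, a i⟩) (Sum.inl ⟨i + 1, a (i + 1)⟩) := fun i =>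
    (hx i (y i)).symm.trans (inflateInsert_adj_leave rfl).reachable
  have hiter : ∀ k : ℕ, (𝓕).Reachable (Sum.inl ⟨0, a 0⟩)
      (Sum.inl ⟨(· + 1)^[k] 0, a ((· + 1)^[k] 0)⟩) := by
    intro k
    induction k with
    | zero => exact SimpleGraph.Reachable.refl _
    | succ k ih =>
      rw [Function.iterate_succ_apply']
      exact ih.trans (hstep _)
  have hall : ∀ z, (𝓕).Reachable (Sum.inl ⟨0, a 0⟩) z := by
    have h0 : ∀ i, (𝓕).Reachable (Sum.inl ⟨0, a 0⟩) (Sum.inl ⟨i, a i⟩) := by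
      intro i
      have hi : ((· + 1)^[i.val] 0 : Fin n) = i := by
        apply Fin.ext
        rw [val_iterate_add_one, Fin.val_zero, zero_add, Nat.mod_eq_of_lt i.isLt]
      have := hiter i.val
      rwa [hi] at this
    rintro (⟨i, s⟩ | ⟨i, s⟩)
    · exact (h0 i).trans (hb i s).symm
    · exact (h0 i).trans (hx i s).symm
  exact (SimpleGraph.connected_iff_exists_forall_reachable _).2 ⟨_, hall⟩

end Lower

end Inflate

/-! ### Upper bound: the two-edge cuts around the pieces and the vertices a path must miss. -/

section Upper

variable {n : ℕ} [NeZero n] {V : Fin n → Type u} {W : Fin n → Type v}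
  {G : ∀ i, SimpleGraph (V i)} {a b : ∀ i, V i} {M : ∀ i, SimpleGraph (W i)} {x y : ∀ i, W i}

local notation "𝓕" => inflateInsert G a b M x y

/-- The vertices of the `i`-th inflator graph. -/
def inflatorSet (V : Fin n → Type u) (W : Fin n → Type v) (i : Fin n) :
    Set ((Σ i, V i) ⊕ (Σ i, W i)) :=
  Set.range fun s : V i => Sum.inl ⟨i, s⟩

/-- The vertices of the `i`-th inserted graph. -/
def insertedSet (V : Fin n → Type u) (W : Fin n → Type v) (i : Fin n) :
    Set ((Σ i, V i) ⊕ (Σ i, W i)) :=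
  Set.range fun s : W i => Sum.inr ⟨i, s⟩

omit [NeZero n] in
theorem inl_mem_inflatorSet {i j : Fin n} {s : V j} :
    Sum.inl ⟨j, s⟩ ∈ inflatorSet V W i ↔ j = i := by
  constructor
  · rintro ⟨t, h⟩
    exact (congrArg position h).symm
  · rintro rfl
    exact ⟨s, rfl⟩

omit [NeZero n] in
theorem inr_notMem_inflatorSet {i : Fin n} {z : Σ i, W i} :
    Sum.inr z ∉ inflatorSet V W i := by
  rintro ⟨t, h⟩
  cases h

omit [NeZero n] in
theorem inr_mem_insertedSet {i j : Fin n} {s : W j} :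
    Sum.inr ⟨j, s⟩ ∈ insertedSet V W i ↔ j = i := by
  constructor
  · rintro ⟨t, h⟩
    exact (congrArg position h).symm
  · rintro rfl
    exact ⟨s, rfl⟩

omit [NeZero n] in
theorem inl_notMem_insertedSet {i : Fin n} {z : Σ i, V i} :
    Sum.inl z ∉ insertedSet V W i := by
  rintro ⟨t, h⟩
  cases h

/-- The edge from the `i`-th inflator graph to the `i`-th inserted graph. -/
def enterEdge (b : ∀ i, V i) (x : ∀ i, W i) (i : Fin n) : Sym2 ((Σ i, V i) ⊕ (Σ i, W i)) :=
  s(Sum.inl ⟨i, b i⟩, Sum.inr ⟨i, x i⟩)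

/-- The edge from the `i`-th inserted graph to the next inflator graph. -/
def leaveEdge (a : ∀ i, V i) (y : ∀ i, W i) (i : Fin n) : Sym2 ((Σ i, V i) ⊕ (Σ i, W i)) :=
  s(Sum.inl ⟨i + 1, a (i + 1)⟩, Sum.inr ⟨i, y i⟩)

theorem inflateInsert_adj_cases {u w : (Σ i, V i) ⊕ (Σ i, W i)} (h : (𝓕).Adj u w) :
    (∃ i, u ∈ inflatorSet V W i ∧ w ∈ inflatorSet V W i) ∨
      (∃ i, u ∈ insertedSet V W i ∧ w ∈ insertedSet V W i) ∨
        ∃ i, s(u, w) = enterEdge b x i ∨ s(u, w) = leaveEdge a y i := by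
  obtain ⟨-, h | h⟩ := h <;> cases h with
  | inflator i s t h => exact Or.inl ⟨i, ⟨_, rfl⟩, ⟨_, rfl⟩⟩
  | inserted i s t h => exact Or.inr (Or.inl ⟨i, ⟨_, rfl⟩, ⟨_, rfl⟩⟩)
  | enter i => first
    | exact Or.inr (Or.inr ⟨i, Or.inl rfl⟩)
    | exact Or.inr (Or.inr ⟨i, Or.inl Sym2.eq_swap⟩)
  | leave i => first
    | exact Or.inr (Or.inr ⟨i, Or.inr rfl⟩)
    | exact Or.inr (Or.inr ⟨i, Or.inr Sym2.eq_swap⟩)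

omit [NeZero n] in
theorem inl_mem_enterEdge {i j : Fin n} {s : V j}
    (h : (Sum.inl ⟨j, s⟩ : (Σ i, V i) ⊕ (Σ i, W i)) ∈ enterEdge b x i) : j = i := by
  rcases Sym2.mem_iff.1 h with h | h
  · exact congrArg position h
  · cases h

theorem inl_mem_leaveEdge {i j : Fin n} {s : V j}
    (h : (Sum.inl ⟨j, s⟩ : (Σ i, V i) ⊕ (Σ i, W i)) ∈ leaveEdge a y i) : j = i + 1 := by
  rcases Sym2.mem_iff.1 h with h | h
  · exact congrArg position h
  · cases h

omit [NeZero n] in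
theorem inr_mem_enterEdge {i j : Fin n} {s : W j}
    (h : (Sum.inr ⟨j, s⟩ : (Σ i, V i) ⊕ (Σ i, W i)) ∈ enterEdge b x i) : j = i := by
  rcases Sym2.mem_iff.1 h with h | h
  · cases h
  · exact congrArg position h

theorem inr_mem_leaveEdge {i j : Fin n} {s : W j}
    (h : (Sum.inr ⟨j, s⟩ : (Σ i, V i) ⊕ (Σ i, W i)) ∈ leaveEdge a y i) : j = i := by
  rcases Sym2.mem_iff.1 h with h | h
  · cases h
  · exact congrArg position h

/-- Indexing by `i + 1` avoids subtraction in `Fin n`: the edge into an inflator graph is the leave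
edge of the preceding index. -/
theorem cutBy_inflatorSet (i : Fin n) :
    CutBy 𝓕 (inflatorSet V W (i + 1)) (leaveEdge a y i) (enterEdge b x (i + 1)) := by
  rintro _ t ⟨s, rfl⟩ ht h
  rcases inflateInsert_adj_cases h with ⟨j, h1, h2⟩ | ⟨j, h1, -⟩ | ⟨j, h1 | h1⟩
  · obtain rfl := inl_mem_inflatorSet.1 h1
    exact absurd h2 ht
  · exact absurd h1 inl_notMem_insertedSet
  · obtain rfl := inl_mem_enterEdge (h1 ▸ Sym2.mem_mk_left _ _)
    exact Or.inr h1
  · obtain rfl := add_right_cancel (inl_mem_leaveEdge (h1 ▸ Sym2.mem_mk_left _ _))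
    exact Or.inl h1

theorem cutBy_insertedSet (i : Fin n) :
    CutBy 𝓕 (insertedSet V W i) (enterEdge b x i) (leaveEdge a y i) := by
  rintro _ t ⟨s, rfl⟩ ht h
  rcases inflateInsert_adj_cases h with ⟨j, h1, -⟩ | ⟨j, h1, h2⟩ | ⟨j, h1 | h1⟩
  · exact absurd h1 inr_notMem_inflatorSet
  · obtain rfl := inr_mem_insertedSet.1 h1
    exact absurd h2 ht
  · obtain rfl := inr_mem_enterEdge (h1 ▸ Sym2.mem_mk_left _ _)
    exact Or.inl h1
  · obtain rfl := inr_mem_leaveEdge (h1 ▸ Sym2.mem_mk_left _ _)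
    exact Or.inr h1

theorem mem_iff_notMem_of_eq {X : Type*} {S : Set X} {u w : X} (h : ¬(u ∈ S ↔ w ∈ S)) (s t : X)
    (hst : s(s, t) = s(u, w)) : s ∈ S ↔ t ∉ S := by
  rcases Sym2.eq_iff.1 hst with ⟨rfl, rfl⟩ | ⟨rfl, rfl⟩ <;> tauto

theorem mem_edges_iff_inflatorSet (i : Fin n) (hab : a (i + 1) ≠ b (i + 1))
    {u w : (Σ i, V i) ⊕ (Σ i, W i)} (p : (𝓕).Walk u w) (hp : p.IsPath) :
    (u ∈ inflatorSet V W (i + 1) ↔ w ∈ inflatorSet V W (i + 1)) ↔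
      (leaveEdge a y i ∈ p.edges ↔ enterEdge b x (i + 1) ∈ p.edges) := by
  refine (cutBy_inflatorSet i).mem_edges_iff ?_ (mem_iff_notMem_of_eq ?_)
    (mem_iff_notMem_of_eq ?_) p hp.isTrail
  · intro h
    rcases Sym2.eq_iff.1 h with ⟨h, -⟩ | ⟨h, -⟩
    · exact hab (inl_injective (W := W) (i + 1) h)
    · cases h
  · simp [inl_mem_inflatorSet, inr_notMem_inflatorSet]
  · simp [inl_mem_inflatorSet, inr_notMem_inflatorSet]

theorem mem_edges_iff_insertedSet (hn : 2 ≤ n) (i : Fin n)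
    {u w : (Σ i, V i) ⊕ (Σ i, W i)} (p : (𝓕).Walk u w) (hp : p.IsPath) :
    (u ∈ insertedSet V W i ↔ w ∈ insertedSet V W i) ↔
      (enterEdge b x i ∈ p.edges ↔ leaveEdge a y i ∈ p.edges) := by
  refine (cutBy_insertedSet i).mem_edges_iff ?_ (mem_iff_notMem_of_eq ?_)
    (mem_iff_notMem_of_eq ?_) p hp.isTrail
  · intro h
    rcases Sym2.eq_iff.1 h with ⟨h, -⟩ | ⟨h, -⟩
    -- The two edges differ even if the anchors coincide, since for `n ≥ 2` they lead to different
    -- inflator graphs.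
    · exact add_one_ne_self hn i (congrArg position h).symm
    · cases h
  · simp [inr_mem_insertedSet, inl_notMem_insertedSet]
  · simp [inr_mem_insertedSet, inl_notMem_insertedSet]

/-- A path between different inflator graphs misses one of the inserted graphs. -/
theorem exists_insertedSet_missed (hn : 2 ≤ n) (hab : ∀ i, a i ≠ b i) {i j : Fin n} (hij : i ≠ j)
    {s : V i} {t : V j} (p : (𝓕).Walk (Sum.inl ⟨i, s⟩) (Sum.inl ⟨j, t⟩)) (hp : p.IsPath) :
    ∃ k, ∀ z : W k, Sum.inr ⟨k, z⟩ ∉ p.support := by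
  suffices h : ∃ k, enterEdge b x k ∉ p.edges ∧ leaveEdge a y k ∉ p.edges by
    obtain ⟨k, h1, h2⟩ := h
    refine ⟨k, fun z hz => ?_⟩
    exact inl_notMem_insertedSet
      (((cutBy_insertedSet k).mem_iff_of_notMem_edges p h1 h2 _ hz).1 ⟨z, rfl⟩)
  have hM : ∀ k, enterEdge b x k ∈ p.edges ↔ leaveEdge a y k ∈ p.edges := fun k =>
    (mem_edges_iff_insertedSet hn k p hp).1 (by simp [inl_notMem_insertedSet])
  obtain ⟨k, rfl⟩ : ∃ k, k + 1 = i := ⟨i - 1, sub_add_cancel i 1⟩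
  have hG := mem_edges_iff_inflatorSet k (hab _) p hp
  simp only [inl_mem_inflatorSet, hij.symm, iff_false, not_true_eq_false, false_iff] at hG
  -- Exactly one end lies in this inflator graph, so exactly one of its two edges is used. The
  -- unused one leads to an inserted graph that contains no end, whose other edge is therefore
  -- unused as well.
  by_cases h : leaveEdge a y k ∈ p.edges
  · have h' : enterEdge b x (k + 1) ∉ p.edges := fun h' => hG (iff_of_true h h')
    exact ⟨k + 1, h', fun h'' => h' ((hM _).2 h'')⟩
  · exact ⟨k, fun h'' => h ((hM _).1 h''), h⟩

theorem eq_or_eq_of_adj_notMem {i : Fin n} {s : V (i + 1)} {t : (Σ i, V i) ⊕ (Σ i, W i)}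
    (h : (𝓕).Adj (Sum.inl ⟨i + 1, s⟩) t) (ht : t ∉ inflatorSet V W (i + 1)) :
    (s = a (i + 1) ∧ s(Sum.inl ⟨i + 1, s⟩, t) = leaveEdge a y i) ∨
      (s = b (i + 1) ∧ s(Sum.inl ⟨i + 1, s⟩, t) = enterEdge b x (i + 1)) := by
  rcases cutBy_inflatorSet i _ t ⟨s, rfl⟩ ht h with h | h
  · refine Or.inl ⟨?_, h⟩
    rcases Sym2.eq_iff.1 h with ⟨h, -⟩ | ⟨h, -⟩
    · exact inl_injective (W := W) (i + 1) h
    · cases h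
  · refine Or.inr ⟨?_, h⟩
    rcases Sym2.eq_iff.1 h with ⟨h, -⟩ | ⟨h, -⟩
    · exact inl_injective (W := W) (i + 1) h
    · cases h

variable [∀ i, Fintype (V i)] [∀ i, Fintype (W i)] {m : ℕ} {κ : Fin n → ℕ}

omit [∀ i, Fintype (W i)] in
/-- A path without ends in the `i`-th inflator graph misses at least `m` of its vertices. -/
theorem exists_list_of_ends_notMem (hG : ∀ i, IsInflator (G i) m (a i) (b i))
    (i : Fin n) {u w : (Σ i, V i) ⊕ (Σ i, W i)}
    (p : (𝓕).Walk u w) (hp : p.IsPath) (hu : u ∉ inflatorSet V W i)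
    (hw : w ∉ inflatorSet V W i) :
    ∃ l : List (V i), l.length + m ≤ Fintype.card (V i) ∧
      ∀ s, Sum.inl ⟨i, s⟩ ∈ p.support → s ∈ l := by
  obtain ⟨i, rfl⟩ : ∃ k, k + 1 = i := ⟨i - 1, sub_add_cancel i 1⟩
  by_cases hz : ∃ s, Sum.inl ⟨i + 1, s⟩ ∈ p.support
  · obtain ⟨z, hz⟩ := hz
    obtain ⟨s, t, s', t', q, hq, hqS, ht, ht', hne, hst, hst', hqm⟩ :=
      (cutBy_inflatorSet i).exists_subpath p hp hu hw hz ⟨z, rfl⟩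
    obtain ⟨s, rfl⟩ := hqS s (by simp)
    obtain ⟨s', rfl⟩ := hqS s' (by simp)
    obtain ⟨r, hr⟩ := exists_walk_of_support_subset_range (inl_injective (i + 1))
      (fun _ _ => inflateInsert_adj_inl.1) q hqS s s' rfl rfl
    have hrp : r.IsPath := by
      rw [SimpleGraph.Walk.isPath_def]
      exact List.Nodup.of_map _ (hr ▸ hq.support_nodup)
    refine ⟨r.support, (hG (i + 1)).length_add_le ?_, ?_⟩
    -- The subpath is entered and left by different edges, so its ends are `a` and `b` in some
    -- order, and the drop applies.
    · rcases eq_or_eq_of_adj_notMem hst ht with ⟨rfl, h1⟩ | ⟨rfl, h1⟩ <;>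
        rcases eq_or_eq_of_adj_notMem hst' ht' with ⟨rfl, h2⟩ | ⟨rfl, h2⟩
      · exact absurd (h1.trans h2.symm) hne
      · exact Or.inl ⟨r, hrp, rfl⟩
      · exact Or.inr ⟨r, hrp, rfl⟩
      · exact absurd (h1.trans h2.symm) hne
    · intro v hv
      have := hqm _ hv ⟨v, rfl⟩
      rw [← hr] at this
      exact (List.mem_map_of_injective (inl_injective (i + 1))).1 this
  · have := (hG (i + 1)).drop_le
    exact ⟨[], by simp; omega, fun s hs => absurd ⟨s, hs⟩ hz⟩

omit [NeZero n] in
open Classical in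
theorem length_eq_sum_card {l : List ((Σ i, V i) ⊕ (Σ i, W i))} (hl : l.Nodup) :
    l.length = ∑ i, (Finset.univ.filter fun s : V i => Sum.inl ⟨i, s⟩ ∈ l).card +
      ∑ i, (Finset.univ.filter fun s : W i => Sum.inr ⟨i, s⟩ ∈ l).card := by
  have h : l.toFinset = Finset.univ.filter (· ∈ l) := by
    ext z
    simp
  rw [← List.toFinset_card_of_nodup hl, h]
  simp only [Finset.card_filter]
  rw [Fintype.sum_sum_type, Fintype.sum_sigma, Fintype.sum_sigma]

theorem length_support_le (hn : 2 ≤ n) (hG : ∀ i, IsInflator (G i) m (a i) (b i))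
    (hκ : ∀ i, κ i + m = Fintype.card (V i)) (hm : ∀ i, m ≤ Fintype.card (W i))
    {u w : (Σ i, V i) ⊕ (Σ i, W i)} (p : (𝓕).Walk u w) (hp : p.IsPath) :
    p.support.length ≤ ∑ j, κ j + ∑ j, Fintype.card (W j) + m := by
  classical
  rw [length_eq_sum_card hp.support_nodup]
  set c : Fin n → ℕ := fun i =>
    (Finset.univ.filter fun s : V i => Sum.inl ⟨i, s⟩ ∈ p.support).card with hc
  set d : Fin n → ℕ := fun i =>
    (Finset.univ.filter fun s : W i => Sum.inr ⟨i, s⟩ ∈ p.support).card with hd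
  have hc1 : ∀ i, c i ≤ κ i + m := fun i => (hκ i).symm ▸ Finset.card_le_univ _
  have hd1 : ∀ i, d i ≤ Fintype.card (W i) := fun i => Finset.card_le_univ _
  have hc2 : ∀ i, u ∉ inflatorSet V W i → w ∉ inflatorSet V W i → c i ≤ κ i := by
    intro i hu hw
    obtain ⟨l, hl, hlm⟩ := exists_list_of_ends_notMem hG i p hp hu hw
    have h1 : c i ≤ l.toFinset.card := by
      refine Finset.card_le_card fun s hs => ?_
      simp only [Finset.mem_filter, Finset.mem_univ, true_and] at hs
      exact List.mem_toFinset.2 (hlm s hs)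
    have h2 := List.toFinset_card_le l
    have h3 := hκ i
    omega
  -- The case in which a single inflator graph contains all ends that lie in inflator graphs: only
  -- that one may be covered completely.
  have hone : ∀ i₀, (∀ i, i ≠ i₀ → u ∉ inflatorSet V W i ∧ w ∉ inflatorSet V W i) →
      ∑ i, c i + ∑ i, d i ≤ ∑ j, κ j + ∑ j, Fintype.card (W j) + m := by
    intro i₀ h
    have h1 : ∑ i, c i ≤ ∑ i, (κ i + if i = i₀ then m else 0) := by
      refine Finset.sum_le_sum fun i _ => ?_
      by_cases hi : i = i₀
      · simpa [hi] using hc1 i₀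
      · simpa [hi] using hc2 i (h i hi).1 (h i hi).2
    have h2 : ∑ i, d i ≤ ∑ i, Fintype.card (W i) := Finset.sum_le_sum fun i _ => hd1 i
    rw [Finset.sum_add_distrib, Finset.sum_ite_eq' Finset.univ i₀] at h1
    simp only [Finset.mem_univ, if_true] at h1
    omega
  rcases u with ⟨i, s⟩ | u <;> rcases w with ⟨j, t⟩ | w
  · by_cases hij : i = j
    · subst hij
      exact hone i fun k hk => by simp [inl_mem_inflatorSet, hk.symm]
    · obtain ⟨k, hk⟩ := exists_insertedSet_missed hn (fun i => (hG i).ne) hij p hp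
      have h1 : ∑ i, c i ≤ ∑ l, ((κ l + if l = i then m else 0) + if l = j then m else 0) := by
        refine Finset.sum_le_sum fun l _ => ?_
        by_cases hi : l = i
        · have := hc1 l
          rw [if_pos hi]
          omega
        · by_cases hj : l = j
          · have := hc1 l
            rw [if_pos hj]
            omega
          · have := hc2 l (by simpa [inl_mem_inflatorSet] using fun h => hi h.symm)
              (by simpa [inl_mem_inflatorSet] using fun h => hj h.symm)
            omega
      -- Two inflator graphs may exceed `κ` by `m` each; missing the whole of `M k` pays for one of
      -- these excesses.
      have h2 : ∑ i, (d i + if i = k then m else 0) ≤ ∑ i, Fintype.card (W i) := by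
        refine Finset.sum_le_sum fun l _ => ?_
        by_cases hl : l = k
        · subst hl
          have h0 : d l = 0 := by
            rw [hd]
            exact Finset.card_eq_zero.2 (Finset.filter_eq_empty_iff.2 fun z _ => hk z)
          rw [h0, if_pos rfl, zero_add]
          exact hm l
        · rw [if_neg hl]
          exact hd1 l
      simp only [Finset.sum_add_distrib, Finset.sum_ite_eq', Finset.mem_univ, if_true] at h1 h2
      change ∑ i, c i + ∑ i, d i ≤ _
      omega
  · exact hone i fun k hk => by simp [inl_mem_inflatorSet, inr_notMem_inflatorSet, hk.symm]
  · exact hone j fun k hk => by simp [inl_mem_inflatorSet, inr_notMem_inflatorSet, hk.symm]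
  · exact hone 0 fun k _ => by simp [inr_notMem_inflatorSet]

end Upper

end Detour

theorem mainTheorem4 (n : ℕ) [NeZero n] (hn : 2 ≤ n) (m : ℕ)
    (V : Fin n → Type u) [∀ i, Fintype (V i)] (W : Fin n → Type v) [∀ i, Fintype (W i)]
    (G : ∀ i, SimpleGraph (V i)) (a b : ∀ i, V i)
    (M : ∀ i, SimpleGraph (W i)) (x y : ∀ i, W i)
    (hG : ∀ i, Detour.IsInflator (G i) m (a i) (b i))
    (hM : ∀ i, Detour.IsHCTV (M i) (x i) (y i))
    (hm : ∀ i, m ≤ Fintype.card (W i)) :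
    Detour.IsCND (Detour.inflateInsert G a b M x y) ∧
      (Detour.order (Detour.inflateInsert G a b M x y) : ℤ) =
        ∑ i, (Fintype.card (V i) : ℤ) + ∑ i, (Fintype.card (W i) : ℤ) - ((n : ℤ) - 1) * m := by
  -- Stating `κ` by an addition keeps truncated subtraction out of all the counts.
  obtain ⟨κ, hκ⟩ : ∃ κ : Fin n → ℕ, ∀ i, κ i + m = Fintype.card (V i) :=
    ⟨fun i => Fintype.card (V i) - m, fun i => by have := (hG i).drop_le; dsimp only; omega⟩
  have hlow : ∀ z, ∃ w l, Detour.PathOn (Detour.inflateInsert G a b M x y) z w l ∧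
      l.length = ∑ j, κ j + ∑ j, Fintype.card (W j) + m := by
    rintro (⟨i, s⟩ | ⟨i, s⟩)
    · exact Detour.exists_pathOn_from_inl hG hM hκ i s
    · exact Detour.exists_pathOn_from_inr hn hG hM hκ i s
  have hup : ∀ z w (p : (Detour.inflateInsert G a b M x y).Walk z w), p.IsPath →
      p.support.length ≤ ∑ j, κ j + ∑ j, Fintype.card (W j) + m := fun z w p hp =>
    Detour.length_support_le hn hG hκ hm p hp
  have hvertex : ∀ z, Detour.vertexOrder (Detour.inflateInsert G a b M x y) z =
      ∑ j, κ j + ∑ j, Fintype.card (W j) + m := by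
    intro z
    obtain ⟨w, l, hl, hlc⟩ := hlow z
    exact le_antisymm (Detour.vertexOrder_le (hup z)) (hlc ▸ hl.length_le_vertexOrder)
  have horder : Detour.order (Detour.inflateInsert G a b M x y) =
      ∑ j, κ j + ∑ j, Fintype.card (W j) + m := by
    obtain ⟨w, l, hl, hlc⟩ := hlow (Sum.inl ⟨0, a 0⟩)
    have : Nonempty ((Σ i, V i) ⊕ (Σ i, W i)) := ⟨w⟩
    exact le_antisymm (Detour.order_le hup) (hlc ▸ hl.length_le_order)
  have hcard : ∑ i, Fintype.card (V i) = ∑ i, κ i + n * m := by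
    simp [← hκ, Finset.sum_add_distrib]
  refine ⟨⟨Detour.inflateInsert_connected hG hM, ?_, fun z w => by rw [hvertex, hvertex]⟩, ?_⟩
  -- A hamiltonian path would force `n * m ≤ m`, against `n ≥ 2` and `m > 0`.
  · intro ht
    obtain ⟨z, w, _, ⟨p, hp, rfl⟩, hl⟩ := ht.exists_pathOn
    have h1 := hup z w p hp
    rw [hl, Fintype.card_sum, Fintype.card_sigma, Fintype.card_sigma, hcard] at h1
    have h2 := (hG 0).drop_pos
    have h3 : 2 * m ≤ n * m := Nat.mul_le_mul_right m hn
    omega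
  · have hcard' : ∑ i, (Fintype.card (V i) : ℤ) = ∑ i, (κ i : ℤ) + n * m := by
      exact_mod_cast hcard
    rw [horder, hcard']
    push_cast
    ring
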